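/- Let $K$ be an algebraically closed field of characteristic $p>0$ and let $n\ge 0$ be an integer. Let $X=(x_{ij})_{1\le i,j\le n}$ be the generic $n\times n$ matrix, $K[X]$ the polynomial ring over $K$ in its $n^2$ entries, and let $\mathfrak P_2\subseteq K[X]$ be the ideal generated by the $2\times 2$ principal minors $x_{ii}x_{jj}-x_{ij}x_{ji}$, $i<j$. Then $R=K[X]/\mathfrak P_2$ is strongly $F$-regular, and it is $F$-regular. Here, for a Noetherian ring $A$ of characteristic $p$, let $A^\circ$ be the set of elements of $A$ that lie in no minimal prime of $A$. - $A$ is *strongly $F$-regular* if it is reduced and $F$-finite (a finitely generated module over its subring of $p$-th powers), and for every $c\in A^\circ$ there is a power $q=p^e$, $e\ge 0$, such that the $A$-linear map $A\to A^{1/q}$, $1\mapsto c^{1/q}$, splits. - The *tight closure* of an ideal $I\subseteq A$ is the set of all $x\in A$ for which there is $c\in A^\circ$ with $c\,x^q\in I^{[q]}$ for all sufficiently large $q=p^e$, where $I^{[q]}$ is the ideal generated by the $q$-th powers of the elements of $I$. The ring $A$ is *weakly $F$-regular* if every ideal of $A$ equals its tight closure, and *$F$-regular* if every localization $W^{-1}A$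 at a multiplicative subset $W$ is weakly $F$-regular. -/

import Mathlib

/-- The ideal `P_t` of `K[X] = K[x_ij : 1 ≤ i, j ≤ n]` generated by the size `t` principal minors
of the generic `n × n` matrix `X = (x_ij)`, i.e. by the determinants of the submatrices whose
row indices and column indices form the same `t`-element set `s`. -/
noncomputable def principalMinorIdeal (K : Type*) [Field K] (n t : ℕ) :
    Ideal (MvPolynomial (Fin n × Fin n) K) :=
  Ideal.span {f | ∃ s : Finset (Fin n), s.card = t ∧
    f = ((Matrix.mvPolynomialX (Fin n) (Fin n) K).submatrix
      (fun i : s => (i : Fin n)) (fun j : s => (j : Fin n))).det}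

/-- The set `R°` of elements of `R` that lie in no minimal prime of `R`. -/
def offMinimalPrimes (R : Type*) [CommRing R] : Set R :=
  {c | ∀ P ∈ minimalPrimes R, c ∉ P}

/-- The Frobenius power `I^[q]`, `q = p ^ e`: the ideal generated by the `q`-th powers of the
elements of `I`. -/
def frobeniusPower {R : Type*} [CommRing R] (p e : ℕ) (I : Ideal R) : Ideal R :=
  Ideal.span ((fun x : R => x ^ p ^ e) '' (I : Set R))

/-- The tight closure `I*` of an ideal `I` in a ring of characteristic `p`: the elements `x` for
which there is `c ∈ R°` with `c * x ^ q ∈ I^[q]` for all sufficiently large `q = p ^ e`. -/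
def tightClosure {R : Type*} [CommRing R] (p : ℕ) (I : Ideal R) : Set R :=
  {x | ∃ c ∈ offMinimalPrimes R, ∃ e₀ : ℕ, ∀ e : ℕ, e₀ ≤ e →
    c * x ^ p ^ e ∈ frobeniusPower p e I}

/-- A Noetherian ring of characteristic `p` is weakly `F`-regular if every ideal is tightly closed.
(Characteristic `p` is expressed by `p = 0` in `R`, so that the zero ring, which occurs as a
localization, is allowed; it is weakly `F`-regular.) -/
structure IsWeaklyFRegular (p : ℕ) (R : Type*) [CommRing R] : Prop where
  prime : p.Prime
  cast_eq_zero : (p : R) = 0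
  noetherian : IsNoetherianRing R
  tightlyClosed : ∀ I : Ideal R, tightClosure p I = (I : Set R)

/-- A Noetherian ring `R` of characteristic `p` is `F`-regular if every localization `W⁻¹R`, for a
multiplicative subset `W` of `R`, is weakly `F`-regular. -/
structure IsFRegular (p : ℕ) (R : Type*) [CommRing R] : Prop where
  prime : p.Prime
  charP : CharP R p
  noetherian : IsNoetherianRing R
  localization : ∀ W : Submonoid R, IsWeaklyFRegular p (Localization W)

/-- A ring of characteristic `p` is `F`-finite if it is a finitely generated module over its
subring of `p`-th powers. -/
def IsFFinite (p : ℕ) (R : Type*) [CommRing R] : Prop :=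
  ∃ s : Finset R, ∀ x : R, ∃ a : R → R, x = ∑ b ∈ s, a b ^ p * b

/-- A reduced Noetherian `F`-finite ring `R` of characteristic `p` is strongly `F`-regular if for
every `c ∈ R°` there is `q = p ^ e` such that the `R`-linear map `R → R^{1/q}`, `1 ↦ c^{1/q}`,
splits. Identifying `R^{1/q}` with `R` through `x^{1/q} ↔ x`, the scalar `r` acts on it as
multiplication by `r ^ q`, so an `R`-linear map `R^{1/q} → R` is an additive map `φ : R → R` with
`φ (r ^ q * x) = r * φ x`, and it is a splitting exactly when `φ c = 1`. -/
structure IsStronglyFRegular (p : ℕ) (R : Type*) [CommRing R] : Prop where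
  prime : p.Prime
  charP : CharP R p
  noetherian : IsNoetherianRing R
  reduced : IsReduced R
  fFinite : IsFFinite p R
  splits : ∀ c ∈ offMinimalPrimes R, ∃ (e : ℕ) (φ : R →+ R),
    (∀ r x : R, φ (r ^ p ^ e * x) = r * φ x) ∧ φ c = 1

/-! The quotient is a normal affine semigroup ring. The binomials are homogeneous for a toric
grading, and modulo them each degree contains exactly one monomial free of the products `x_ij x_ji`,
`i ≠ j`; so the quotient embeds in a Laurent polynomial ring (`ker_toric`), with image spanned by
the lattice points of a cone (`mem_range_toric`). Given `c ≠ 0`, pick an exponent `m` of `c` and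
send `x^(m + q t)` to `x^t`, all other monomials to zero. For large `q` no other exponent of `c` is
congruent to `m` modulo `q`, so `c` goes to a nonzero constant (`exists_frobeniusTrace_eq_single`),
and the map preserves the semigroup ring (`isDegree_of_add_nsmul`). Rescaling gives a splitting for
every large `q`. Applying it to `c x^q ∈ I^[q]` gives `x ∈ I`, also after localization
(`tightClosure_eq`). -/

/-! ### Frobenius splittings and tight closure -/

theorem mem_offMinimalPrimes_iff {R : Type*} [CommRing R] [IsDomain R] {c : R} :
    c ∈ offMinimalPrimes R ↔ c ≠ 0 := by
  simp [offMinimalPrimes, IsDomain.minimalPrimes_eq_singleton_bot]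

theorem offMinimalPrimes_of_subsingleton {R : Type*} [CommRing R] [Subsingleton R] (c : R) :
    c ∈ offMinimalPrimes R := by
  intro P hP
  exact absurd (Subsingleton.elim _ _) hP.1.1.ne_top

/-- Every nonzero element `c` of `R` admits, for all large `e`, an additive map `φ` which is linear
along the `e`-th iterate of the Frobenius and satisfies `φ c = 1`. -/
def HasFrobeniusSplittings (p : ℕ) (R : Type*) [CommRing R] : Prop :=
  ∀ c : R, c ≠ 0 → ∃ e₀ : ℕ, ∀ e, e₀ ≤ e → ∃ φ : R →+ R,
    (∀ r x : R, φ (r ^ p ^ e * x) = r * φ x) ∧ φ c = 1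

theorem pow_mem_frobeniusPower {R : Type*} [CommRing R] (p e : ℕ) {I : Ideal R} {x : R}
    (hx : x ∈ I) : x ^ p ^ e ∈ frobeniusPower p e I :=
  Ideal.subset_span ⟨x, hx, rfl⟩

theorem subset_tightClosure {R : Type*} [CommRing R] (p : ℕ) (I : Ideal R)
    (h : (1 : R) ∈ offMinimalPrimes R) : (I : Set R) ⊆ tightClosure p I :=
  fun x hx => ⟨1, h, 0, fun e _ => by simpa using pow_mem_frobeniusPower p e hx⟩

/-- On generators, `φ (r * y ^ q) = y * φ r`. -/
theorem map_mem_of_mem_frobeniusPower {R : Type*} [CommRing R] {p e : ℕ} {I : Ideal R}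
    (φ : R →+ R) (hφ : ∀ r x : R, φ (r ^ p ^ e * x) = r * φ x) {x : R}
    (hx : x ∈ frobeniusPower p e I) : φ x ∈ I := by
  unfold frobeniusPower at hx
  induction hx using Submodule.closure_induction with
  | zero => simp
  | add x y _ _ hx hy => simpa using I.add_mem hx hy
  | smul_mem r x hx =>
    obtain ⟨y, hy, rfl⟩ := hx
    rw [smul_eq_mul, mul_comm, hφ]
    exact I.mul_mem_right _ hy

theorem frobeniusPower_le_map_comap {R S : Type*} [CommRing R] [CommRing S] [Algebra R S]
    (W : Submonoid R) [IsLocalization W S] (p e : ℕ) (I : Ideal S) :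
    frobeniusPower p e I ≤
      (frobeniusPower p e (I.comap (algebraMap R S))).map (algebraMap R S) := by
  refine Ideal.span_le.2 ?_
  rintro _ ⟨z, hz, rfl⟩
  obtain ⟨⟨j, u⟩, hju⟩ := IsLocalization.surj W z
  have hj : j ∈ I.comap (algebraMap R S) := by
    rw [Ideal.mem_comap, ← hju]
    exact I.mul_mem_right _ hz
  have h := Ideal.mem_map_of_mem (algebraMap R S) (pow_mem_frobeniusPower p e hj)
  rw [map_pow, ← hju, mul_pow] at h
  exact (Ideal.mul_unit_mem_iff_mem _ ((IsLocalization.map_units S u).pow _)).1 h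

/-- Denominators are cleared so that only splittings of `R` itself are needed, for every
localization `S`. -/
theorem HasFrobeniusSplittings.tightClosure_eq {p : ℕ} (hp : p ≠ 0) {R S : Type*} [CommRing R]
    [IsDomain R] [CommRing S] [Algebra R S] (h : HasFrobeniusSplittings p R) (W : Submonoid R)
    [IsLocalization W S] (I : Ideal S) : tightClosure p I = (I : Set S) := by
  cases subsingleton_or_nontrivial S with
  | inl hS =>
    refine subset_antisymm (fun x _ => ?_) (subset_tightClosure p I
      (offMinimalPrimes_of_subsingleton _))
    rw [Subsingleton.elim x 0]
    exact I.zero_mem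
  | inr hS =>
    have hW : W ≤ nonZeroDivisors R := by
      refine le_nonZeroDivisors_of_noZeroDivisors fun h0 => ?_
      have := IsLocalization.map_units S (⟨0, h0⟩ : W)
      simp at this
    have : IsDomain S := IsLocalization.isDomain_of_le_nonZeroDivisors S hW
    refine subset_antisymm ?_ (subset_tightClosure p I
      (mem_offMinimalPrimes_iff.2 one_ne_zero))
    rintro x ⟨c, hc, e₀, hx⟩
    obtain ⟨⟨d, v⟩, hd⟩ := IsLocalization.surj W c
    obtain ⟨⟨a, w⟩, ha⟩ := IsLocalization.surj W x
    have hd0 : d ≠ 0 := by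
      rintro rfl
      rw [map_zero] at hd
      exact mem_offMinimalPrimes_iff.1 hc
        (((IsLocalization.map_units S v).mul_left_eq_zero).1 hd)
    -- Membership is known only for `e ≥ e₀`, so a splitting is needed for all large `e`, not just
    -- for one.
    obtain ⟨e₁, he₁⟩ := h d hd0
    set e := max e₀ e₁
    obtain ⟨φ, hφ, hφd⟩ := he₁ e (le_max_right _ _)
    have hmem : algebraMap R S (d * a ^ p ^ e) ∈
        (frobeniusPower p e (I.comap (algebraMap R S))).map (algebraMap R S) := by
      have := frobeniusPower_le_map_comap W p e I (hx e (le_max_left _ _))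
      rw [map_mul, map_pow, ← hd, ← ha,
        show c * algebraMap R S v * (x * algebraMap R S w) ^ p ^ e =
          algebraMap R S v * algebraMap R S w ^ p ^ e * (c * x ^ p ^ e) by ring]
      exact Ideal.mul_mem_left _ _ this
    obtain ⟨u, hu, hmem⟩ := (IsLocalization.algebraMap_mem_map_algebraMap_iff W S _ _).1 hmem
    have hua : u * a ∈ I.comap (algebraMap R S) := by
      -- The factor `u ^ (q - 1)` completes `u` to a `q`-th power, which `φ` can extract together
      -- with `a ^ q`.
      have key := map_mem_of_mem_frobeniusPower φ hφ
        (Ideal.mul_mem_left _ (u ^ (p ^ e - 1)) hmem)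
      rwa [show u ^ (p ^ e - 1) * (u * (d * a ^ p ^ e)) = (u * a) ^ p ^ e * d by
        rw [mul_pow, ← pow_sub_one_mul (pow_ne_zero e hp) u]; ring, hφ, hφd, mul_one] at key
    rw [Ideal.mem_comap, map_mul, ← ha, mul_comm,
      Ideal.mul_unit_mem_iff_mem _ (IsLocalization.map_units S ⟨u, hu⟩)] at hua
    exact (Ideal.mul_unit_mem_iff_mem _ (IsLocalization.map_units S w)).1 hua

theorem HasFrobeniusSplittings.isFRegular {p : ℕ} (hp : p.Prime) {R : Type*} [CommRing R]
    [IsDomain R] [CharP R p] [IsNoetherianRing R] (h : HasFrobeniusSplittings p R) :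
    IsFRegular p R where
  prime := hp
  charP := inferInstance
  noetherian := inferInstance
  localization W :=
    { prime := hp
      cast_eq_zero := by
        rw [← map_natCast (algebraMap R (Localization W)), CharP.cast_eq_zero, map_zero]
      noetherian := IsLocalization.isNoetherianRing W _ inferInstance
      tightlyClosed := h.tightClosure_eq hp.ne_zero W }

theorem HasFrobeniusSplittings.isStronglyFRegular {p : ℕ} (hp : p.Prime) {R : Type*} [CommRing R]
    [IsDomain R] [CharP R p] [IsNoetherianRing R] (h : HasFrobeniusSplittings p R)
    (hF : IsFFinite p R) : IsStronglyFRegular p R where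
  prime := hp
  charP := inferInstance
  noetherian := inferInstance
  reduced := inferInstance
  fFinite := hF
  splits c hc := by
    obtain ⟨e, he⟩ := h c (mem_offMinimalPrimes_iff.1 hc)
    exact ⟨e, he e le_rfl⟩

/-! ### F-finiteness -/

/-- A finitely generated algebra over a perfect field is `F`-finite. -/
theorem isFFinite_of_surjective {K σ R : Type*} [Field K] [Finite σ] [CommRing R] (p : ℕ)
    [Fact p.Prime] [CharP K p] [PerfectRing K p] [CharP R p] (f : MvPolynomial σ K →+* R)
    (hf : Function.Surjective f) : IsFFinite p R := by
  classical
  have hp : p.Prime := Fact.out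
  cases nonempty_fintype σ
  -- Generators: the monomials with all exponents below `p`.
  let s : Finset R := (Fintype.piFinset fun _ : σ => Finset.range p).image fun d =>
    f (MvPolynomial.monomial (Finsupp.equivFunOnFinite.symm d) 1)
  refine ⟨s, fun x => ?_⟩
  obtain ⟨P, rfl⟩ := hf x
  induction P using MvPolynomial.induction_on' with
  | add P Q hP hQ =>
    obtain ⟨a, ha⟩ := hP
    obtain ⟨b, hb⟩ := hQ
    refine ⟨a + b, ?_⟩
    simp only [map_add, ha, hb, Pi.add_apply, add_pow_char, add_mul, Finset.sum_add_distrib]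
  | monomial d k =>
    obtain ⟨l, rfl⟩ := (PerfectRing.bijective_frobenius (R := K) (p := p)).2 k
    let r : σ → ℕ := fun i => d i % p
    let t : σ →₀ ℕ := Finsupp.equivFunOnFinite.symm fun i => d i / p
    have hr : f (MvPolynomial.monomial (Finsupp.equivFunOnFinite.symm r) 1) ∈ s :=
      Finset.mem_image_of_mem _ (Fintype.mem_piFinset.2 fun i =>
        Finset.mem_range.2 (Nat.mod_lt _ hp.pos))
    refine ⟨fun b => if b = f (MvPolynomial.monomial (Finsupp.equivFunOnFinite.symm r) 1) then
      f (MvPolynomial.monomial t l) else 0, ?_⟩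
    rw [Finset.sum_eq_single_of_mem _ hr fun b _ hb => by simp [hb, hp.ne_zero]]
    simp only [if_true]
    rw [← map_pow, ← map_mul, MvPolynomial.monomial_pow, MvPolynomial.monomial_mul, mul_one]
    suffices h : d = p • t + Finsupp.equivFunOnFinite.symm r by rw [← h]
    ext i
    simp [r, t, Nat.div_add_mod]

/-! ### Frobenius traces on group algebras -/

namespace AddMonoidAlgebra

variable {K M : Type*} [Field K] [AddCommGroup M]

theorem add_nsmul_injective [IsAddTorsionFree M] {q : ℕ} (hq : q ≠ 0) (m : M) :
    Function.Injective fun t : M => m + q • t :=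
  (add_right_injective m).comp (nsmul_right_injective hq)

/-- Such a `k` divides a nonzero coordinate of `d`. -/
theorem exists_forall_eq_nsmul_le [Module.Free ℤ M] {d : M} (hd : d ≠ 0) :
    ∃ N : ℕ, ∀ (k : ℕ) (t : M), d = k • t → k ≤ N := by
  let b := Module.Free.chooseBasis ℤ M
  obtain ⟨i, hi⟩ : ∃ i, b.repr d i ≠ 0 := by
    by_contra! h
    exact hd (b.repr.map_eq_zero_iff.1 (Finsupp.ext h))
  refine ⟨(b.repr d i).natAbs, fun k t hk => Nat.le_of_dvd (Int.natAbs_pos.2 hi) ?_⟩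
  rw [← Int.natCast_dvd, hk, map_nsmul]
  exact ⟨b.repr t i, by simp⟩

variable [IsAddTorsionFree M] (p : ℕ) [Fact p.Prime] [CharP K p] [PerfectRing K p]

/-- The map `x ^ (m + p ^ e • t) ↦ x ^ t` on monomials, which kills the monomials whose exponent is
not congruent to `m` modulo `p ^ e` and takes `p ^ e`-th roots of coefficients. -/
noncomputable def frobeniusTrace (e : ℕ) (m : M) : AddMonoidAlgebra K M →+ AddMonoidAlgebra K M where
  toFun f := (f.comapDomain (fun t : M => m + p ^ e • t)
    (add_nsmul_injective (pow_ne_zero _ (Fact.out : p.Prime).ne_zero) m)).map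
      (iterateFrobeniusEquiv K p e).symm.toAddMonoidHom
  map_zero' := by simp
  map_add' f g := by rw [comapDomain_add, AddMonoidAlgebra.map_add]

theorem coeff_frobeniusTrace (e : ℕ) (m t : M) (f : AddMonoidAlgebra K M) :
    (frobeniusTrace p e m f).coeff t =
      (iterateFrobeniusEquiv K p e).symm (f.coeff (m + p ^ e • t)) := by
  simp [frobeniusTrace]

theorem frobeniusTrace_pow_mul (e : ℕ) (m : M) (g f : AddMonoidAlgebra K M) :
    frobeniusTrace p e m (g ^ p ^ e * f) = g * frobeniusTrace p e m f := by
  have : CharP (AddMonoidAlgebra K M) p := 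
    charP_of_injective_algebraMap (algebraMap K (AddMonoidAlgebra K M)).injective p
  induction g using AddMonoidAlgebra.induction_linear with
  | zero => simp [(Fact.out : p.Prime).ne_zero]
  | add x y hx hy => rw [add_pow_char_pow, add_mul, map_add, hx, hy, add_mul]
  | single r k =>
    ext t
    rw [single_pow, coeff_frobeniusTrace,
      coeff_single_mul_eq_mul_coeff (m₂ := m + p ^ e • (t - r)) (by
        intro m' _; rw [smul_sub, ← add_sub_assoc, eq_sub_iff_add_eq, add_comm]),
      coeff_single_mul_eq_mul_coeff (m₂ := t - r) (by
        intro m' _; rw [eq_sub_iff_add_eq, add_comm]), coeff_frobeniusTrace, map_mul]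
    congr 1
    rw [RingEquiv.symm_apply_eq, iterateFrobeniusEquiv_apply, iterateFrobenius_def]

theorem exists_frobeniusTrace_eq_single [Module.Free ℤ M] (c : AddMonoidAlgebra K M) {m : M}
    (hm : c.coeff m ≠ 0) :
    ∃ e₀ : ℕ, ∀ e, e₀ ≤ e → ∃ k : K, k ≠ 0 ∧ frobeniusTrace p e m c = single 0 k := by
  have h (s : M) : ∃ N : ℕ, s - m ≠ 0 → ∀ (k : ℕ) (t : M), s - m = k • t → k ≤ N := by
    by_cases hs : s - m = 0
    · exact ⟨0, fun h => absurd hs h⟩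
    · exact (exists_forall_eq_nsmul_le hs).imp fun N hN _ => hN
  choose N hN using h
  refine ⟨c.coeff.support.sup N, fun e he => ⟨(iterateFrobeniusEquiv K p e).symm (c.coeff m),
    by simpa using hm, ?_⟩⟩
  ext t
  rw [coeff_frobeniusTrace, coeff_single]
  rcases eq_or_ne t 0 with rfl | ht
  · simp
  rw [Finsupp.single_eq_of_ne ht, EmbeddingLike.map_eq_zero_iff]
  by_contra hne
  have hq : p ^ e ≠ 0 := pow_ne_zero _ (Fact.out : p.Prime).ne_zero
  -- A second exponent `m + p ^ e • t` of `c` would force `p ^ e ≤ N ≤ e`.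
  have h1 := hN (m + p ^ e • t) (by
    rw [add_sub_cancel_left]; exact smul_ne_zero hq ht) (p ^ e) t (by simp)
  have h2 : N (m + p ^ e • t) ≤ e :=
    (Finset.le_sup (f := N) (Finsupp.mem_support_iff.2 hne)).trans he
  exact absurd (h1.trans h2) (not_le.2 (Nat.lt_pow_self (Fact.out : p.Prime).one_lt))

end AddMonoidAlgebra

/-! ### The toric grading and its semigroup of degrees -/

namespace PrincipalMinors

open MvPolynomial

variable {ι : Type*} [Fintype ι]

/-- The degree of the monomial with exponent `d` in the toric grading in which `x_ij` has degree
`(e_i, e_ij - e_ji)`. -/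
def degree (d : ι × ι →₀ ℕ) : (ι → ℤ) × (ι × ι → ℤ) :=
  (fun i => ∑ j, (d (i, j) : ℤ), fun a => (d a : ℤ) - d a.swap)

theorem degree_zero : degree (0 : ι × ι →₀ ℕ) = 0 := by
  ext <;> simp [degree]

theorem degree_add (d d' : ι × ι →₀ ℕ) : degree (d + d') = degree d + degree d' := by
  ext
  · simp [degree, Finset.sum_add_distrib]
  · simp only [degree, Finsupp.add_apply, Nat.cast_add, Prod.snd_add, Pi.add_apply]; ring

theorem degree_nsmul (k : ℕ) (d : ι × ι →₀ ℕ) : degree (k • d) = k • degree d := by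
  induction k with
  | zero => simp [degree_zero]
  | succ k ih => rw [succ_nsmul, succ_nsmul, degree_add, ih]

/-- The degrees of the monomials. -/
structure IsDegree (s : (ι → ℤ) × (ι × ι → ℤ)) : Prop where
  swap : ∀ i j, s.2 (j, i) = -s.2 (i, j)
  sum_le : ∀ i, ∑ j, max (s.2 (i, j)) 0 ≤ s.1 i

theorem isDegree_degree (d : ι × ι →₀ ℕ) : IsDegree (degree d) where
  swap i j := by simp [degree]
  sum_le i := Finset.sum_le_sum fun j _ => by simp [degree]

/-- If `m + q • t` is a degree and `q` is large with respect to `m`, then `t` is a degree. -/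
theorem isDegree_of_add_nsmul {m t : (ι → ℤ) × (ι × ι → ℤ)} {q : ℕ} (hm : IsDegree m)
    (hq : ∀ i, m.1 i + ∑ j, |m.2 (i, j)| < q) (h : IsDegree (m + q • t)) : IsDegree t where
  swap i j := by
    have h1 := h.swap i j
    have h2 := hm.swap i j
    simp only [Prod.snd_add, Prod.smul_snd, Pi.add_apply, Pi.smul_apply] at h1
    simp only [nsmul_eq_mul] at h1
    have h3 : 0 ≤ ∑ k, max (m.2 (i, k)) 0 := Finset.sum_nonneg fun _ _ => le_max_right _ _
    have h4 : 0 ≤ ∑ k, |m.2 (i, k)| := Finset.sum_nonneg fun _ _ => abs_nonneg _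
    have hq0 : (0 : ℤ) < q := by linarith [hq i, hm.sum_le i]
    refine mul_left_cancel₀ hq0.ne' ?_
    linarith
  sum_le i := by
    have h1 := h.sum_le i
    simp only [Prod.snd_add, Prod.smul_snd, Pi.add_apply, Pi.smul_apply, Prod.fst_add,
      Prod.smul_fst] at h1
    simp only [nsmul_eq_mul] at h1
    have h2 : (q : ℤ) * ∑ j, max (t.2 (i, j)) 0 ≤
        ∑ j, max (m.2 (i, j) + q * t.2 (i, j)) 0 + ∑ j, |m.2 (i, j)| := by
      rw [Finset.mul_sum, ← Finset.sum_add_distrib]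
      refine Finset.sum_le_sum fun j _ => ?_
      rw [mul_max_of_nonneg _ _ (Int.natCast_nonneg q), mul_zero]
      rcases abs_cases (m.2 (i, j)) with h | h <;> omega
    -- The error from `m` is less than `q`, so integrality turns this strict bound into the required
    -- inequality.
    have h3 : (q : ℤ) * (∑ j, max (t.2 (i, j)) 0) < q * (t.1 i + 1) := by
      linarith [hq i]
    have := lt_of_mul_lt_mul_left h3 (Int.natCast_nonneg q)
    omega

variable {K : Type*} [Field K]

variable (K ι) in
/-- The toric parametrization of the vanishing locus of the `2 × 2` principal minors. -/
noncomputable def toric :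
    MvPolynomial (ι × ι) K →ₐ[K] AddMonoidAlgebra K ((ι → ℤ) × (ι × ι → ℤ)) :=
  aeval fun a => .single (degree (Finsupp.single a 1)) 1

theorem toric_monomial (d : ι × ι →₀ ℕ) (k : K) :
    toric ι K (monomial d k) = .single (degree d) k := by
  have h1 : toric ι K (monomial d 1) = .single (degree d) 1 := by
    induction d using Finsupp.induction_linear with
    | zero => rw [monomial_zero', C_1, map_one, degree_zero, AddMonoidAlgebra.one_def]
    | add d d' h h' =>
      rw [← one_mul (1 : K), ← monomial_mul, map_mul, h, h', AddMonoidAlgebra.single_mul_single,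
        degree_add]
    | single a k =>
      rw [← X_pow_eq_monomial, map_pow, toric, aeval_X, AddMonoidAlgebra.single_pow, one_pow,
        ← degree_nsmul, Finsupp.smul_single, smul_eq_mul, mul_one]
  rw [show monomial d k = k • monomial d (1 : K) by rw [smul_monomial, smul_eq_mul, mul_one],
    map_smul, h1, AddMonoidAlgebra.smul_single, smul_eq_mul, mul_one]

variable [DecidableEq ι]

theorem degree_single (i j : ι) : degree (Finsupp.single (i, j) 1) =
    (Pi.single i 1, Pi.single (i, j) 1 - Pi.single (j, i) 1) := by
  ext a
  · by_cases h : a = i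
    · subst h; simp [degree, Finsupp.single_apply, Finset.sum_ite_eq, -Finset.sum_boole]
    · simp [degree, Finsupp.single_apply, h, Ne.symm h]
  · obtain ⟨k, l⟩ := a
    simp [degree, Finsupp.single_apply, Pi.single_apply, eq_comm, and_comm]

theorem degree_diagonal_pair (i j : ι) :
    degree (Finsupp.single (i, i) 1 + Finsupp.single (j, j) 1) =
      degree (Finsupp.single (i, j) 1 + Finsupp.single (j, i) 1) := by
  simp [degree_add, degree_single]

/-! ### Standard monomials and the toric kernel -/

/-- The exponent of a monomial not divisible by any `x_ij x_ji` with `i ≠ j`, of given degree. -/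
noncomputable def standardExponent (s : (ι → ℤ) × (ι × ι → ℤ)) : ι × ι →₀ ℕ :=
  Finsupp.equivFunOnFinite.symm fun a =>
    if a.1 = a.2 then (s.1 a.1 - ∑ j, max (s.2 (a.1, j)) 0).toNat else (s.2 a).toNat

theorem IsDegree.degree_standardExponent {s : (ι → ℤ) × (ι × ι → ℤ)} (hs : IsDegree s) :
    degree (standardExponent s) = s := by
  have hdiag (i : ι) : s.2 (i, i) = 0 := by have := hs.swap i i; omega
  ext a
  · have h1 : ∀ j, (standardExponent s (a, j) : ℤ) = max (s.2 (a, j)) 0 +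
        if a = j then (s.1 a - ∑ j, max (s.2 (a, j)) 0) else 0 := by
      intro j
      by_cases h : a = j
      · subst h
        simp [standardExponent, hdiag, hs.sum_le a]
      · simp [standardExponent, h]
    simp [degree, h1, Finset.sum_add_distrib]
  · obtain ⟨i, j⟩ := a
    by_cases h : i = j
    · subst h; simp [degree, hdiag]
    · have := hs.swap i j
      simp only [degree, standardExponent, Finsupp.equivFunOnFinite_symm_apply_apply, h, Ne.symm h,
        Prod.swap, if_false, Int.ofNat_toNat]
      omega

theorem standardExponent_degree {d : ι × ι →₀ ℕ}
    (h : ∀ i j, i ≠ j → d (i, j) = 0 ∨ d (j, i) = 0) : standardExponent (degree d) = d := by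
  ext ⟨i, j⟩
  by_cases hij : i = j
  · subst hij
    have h1 : ∀ j, max ((d (i, j) : ℤ) - d (j, i)) 0 =
        (d (i, j) : ℤ) - if i = j then (d (i, i) : ℤ) else 0 := by
      intro j
      by_cases hj : i = j
      · subst hj; simp
      · have := h i j hj
        simp only [hj, if_false]
        omega
    simp [standardExponent, degree, h1]
  · have := h i j hij
    simp only [degree, standardExponent, Finsupp.equivFunOnFinite_symm_apply_apply, hij,
        Prod.swap, if_false]
    omega

theorem mem_range_toric {f : AddMonoidAlgebra K ((ι → ℤ) × (ι × ι → ℤ))} :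
    f ∈ (toric ι K).range ↔ ∀ s, f.coeff s ≠ 0 → IsDegree s := by
  constructor
  · rintro ⟨P, rfl⟩
    induction P using MvPolynomial.induction_on' with
    | monomial d k =>
      intro s hs
      change (toric ι K _).coeff s ≠ 0 at hs
      rw [toric_monomial, AddMonoidAlgebra.coeff_single] at hs
      by_cases h : s = degree d
      · exact h ▸ isDegree_degree d
      · exact absurd (Finsupp.single_eq_of_ne h) hs
    | add P Q hP hQ =>
      intro s hs
      change ∀ s, (toric ι K P).coeff s ≠ 0 → _ at hP
      change ∀ s, (toric ι K Q).coeff s ≠ 0 → _ at hQ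
      change (toric ι K _).coeff s ≠ 0 at hs
      by_contra h
      rw [map_add, AddMonoidAlgebra.coeff_add, Finsupp.add_apply, not_imp_comm.1 (hP s) h,
        not_imp_comm.1 (hQ s) h, add_zero] at hs
      exact hs rfl
  · intro h
    rw [← f.sum_coeff_single]
    refine Subalgebra.sum_mem _ fun s hs => ⟨monomial (standardExponent s) (f.coeff s), ?_⟩
    change toric ι K _ = _
    rw [toric_monomial, (h s (Finsupp.mem_support_iff.1 hs)).degree_standardExponent]

/-- The ideal of the `2 × 2` principal minors. -/
noncomputable def minorIdeal (ι K : Type*) [Field K] : Ideal (MvPolynomial (ι × ι) K) :=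
  Ideal.span {f | ∃ i j : ι, i ≠ j ∧ f = X (i, i) * X (j, j) - X (i, j) * X (j, i)}

theorem minorIdeal_le_ker : minorIdeal ι K ≤ RingHom.ker (toric ι K) := by
  refine Ideal.span_le.2 ?_
  rintro _ ⟨i, j, -, rfl⟩
  rw [SetLike.mem_coe, RingHom.mem_ker, map_sub, map_mul, map_mul, sub_eq_zero]
  simp only [toric, aeval_X, AddMonoidAlgebra.single_mul_single, ← degree_add]
  rw [degree_diagonal_pair]

/-- Rewriting `x_ij x_ji` as `x_ii x_jj` keeps the toric degree and the class but lowers the total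
off-diagonal exponent, so it ends at a standard monomial. -/
theorem mk_monomial_standardExponent (d : ι × ι →₀ ℕ) :
    Ideal.Quotient.mk (minorIdeal ι K) (monomial (standardExponent (degree d)) 1) =
      Ideal.Quotient.mk (minorIdeal ι K) (monomial d 1) := by
  induction hN : ∑ a : ι × ι with a.1 ≠ a.2, d a using Nat.strong_induction_on generalizing d with
  | _ N ih =>
  by_cases h : ∀ i j, i ≠ j → d (i, j) = 0 ∨ d (j, i) = 0
  · rw [standardExponent_degree h]
  push Not at h
  obtain ⟨i, j, hij, h1, h2⟩ := h
  have hle : Finsupp.single (i, j) 1 + Finsupp.single (j, i) 1 ≤ d := by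
    intro a
    by_cases ha : a = (i, j)
    · subst ha
      have : (j, i) ≠ (i, j) := by simp [hij, Ne.symm hij]
      simpa [Finsupp.single_apply, this] using Nat.one_le_iff_ne_zero.2 h1
    · by_cases hb : a = (j, i)
      · subst hb
        simpa [Finsupp.single_apply, Ne.symm ha] using Nat.one_le_iff_ne_zero.2 h2
      · simp [Ne.symm ha, Ne.symm hb]
  obtain ⟨d', rfl⟩ := exists_add_of_le hle
  have hlt : ∑ a : ι × ι with a.1 ≠ a.2,
      (Finsupp.single (i, i) 1 + Finsupp.single (j, j) 1 + d' : ι × ι →₀ ℕ) a < N := by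
    rw [← hN]
    refine Finset.sum_lt_sum (fun a ha => ?_) ⟨(i, j), by simpa using hij, ?_⟩
    · have ha' : a.1 ≠ a.2 := by simpa using ha
      have hi : (i, i) ≠ a := by rintro rfl; exact ha' rfl
      have hj : (j, j) ≠ a := by rintro rfl; exact ha' rfl
      simp [Finsupp.single_apply, hi, hj]
    · simp [hij, Ne.symm hij]
  have key := ih _ hlt _ rfl
  rw [degree_add, degree_diagonal_pair, ← degree_add] at key
  rw [key, Ideal.Quotient.eq]
  have hmem : X (i, i) * X (j, j) - X (i, j) * X (j, i) ∈ minorIdeal ι K :=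
    Ideal.subset_span ⟨i, j, hij, rfl⟩
  convert Ideal.mul_mem_right (monomial d' 1) _ hmem using 1
  simp [X, sub_mul, monomial_mul]

/-- The linear map `σ`, sending each degree to the class of its standard monomial, recovers the
quotient map from `toric`. -/
theorem ker_toric : RingHom.ker (toric ι K) = minorIdeal ι K := by
  refine le_antisymm (fun f hf => ?_) minorIdeal_le_ker
  let σ : AddMonoidAlgebra K ((ι → ℤ) × (ι × ι → ℤ)) →ₗ[K]
      MvPolynomial (ι × ι) K ⧸ minorIdeal ι K :=
    (Finsupp.lsum K fun s => (Ideal.Quotient.mkₐ K (minorIdeal ι K)).toLinearMap ∘ₗ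
      monomial (standardExponent s)) ∘ₗ (AddMonoidAlgebra.coeffLinearEquiv K).toLinearMap
  have h : σ ∘ₗ (toric ι K).toLinearMap = (Ideal.Quotient.mkₐ K (minorIdeal ι K)).toLinearMap := by
    refine MvPolynomial.linearMap_ext fun d => LinearMap.ext_ring ?_
    simp [σ, toric_monomial, mk_monomial_standardExponent]
  have h2 := LinearMap.congr_fun h f
  simp only [LinearMap.comp_apply, AlgHom.toLinearMap_apply, RingHom.mem_ker.1 hf, map_zero,
    Ideal.Quotient.mkₐ_eq_mk] at h2
  exact Ideal.Quotient.eq_zero_iff_mem.1 h2.symm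

end PrincipalMinors

/-! ### Splittings on the quotient by the principal minors -/

namespace PrincipalMinors

open MvPolynomial

variable {ι K : Type*} [Field K]

theorem exists_det_submatrix_mvPolynomialX_eq [DecidableEq ι] {s : Finset ι}
    (hs : s.card = 2) :
    ∃ a ∈ s, ∃ b ∈ s, a ≠ b ∧ ((Matrix.mvPolynomialX ι ι K).submatrix
      (fun i : s => (i : ι)) (fun j : s => (j : ι))).det =
        X (a, a) * X (b, b) - X (a, b) * X (b, a) := by
  let e := (s.equivFinOfCardEq hs).symm
  refine ⟨e 0, (e 0).2, e 1, (e 1).2, fun h => by simpa using e.injective (Subtype.ext h), ?_⟩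
  rw [← Matrix.det_submatrix_equiv_self e, Matrix.det_fin_two]
  rfl

variable [Fintype ι]

theorem hasFrobeniusSplittings_of_range {R : Type*} [CommRing R] (p : ℕ) [Fact p.Prime] [CharP K p]
    [PerfectRing K p] (ψ : R →+* AddMonoidAlgebra K ((ι → ℤ) × (ι × ι → ℤ)))
    (hψ : Function.Injective ψ)
    (hrange : ∀ f, f ∈ ψ.range ↔ ∀ s, f.coeff s ≠ 0 → IsDegree s) :
    HasFrobeniusSplittings p R := by
  intro c hc
  obtain ⟨m, hm⟩ : ∃ m, (ψ c).coeff m ≠ 0 := by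
    by_contra! h
    exact hc ((map_eq_zero_iff ψ hψ).1 (AddMonoidAlgebra.coeff_eq_zero.1 (Finsupp.ext h)))
  have hmdeg : IsDegree m := (hrange _).1 ⟨c, rfl⟩ m hm
  obtain ⟨e₀, he₀⟩ := AddMonoidAlgebra.exists_frobeniusTrace_eq_single p (ψ c) hm
  let B (i : ι) : ℕ := (m.1 i + ∑ j, |m.2 (i, j)|).toNat
  refine ⟨max e₀ (Finset.univ.sup B), fun e he => ?_⟩
  have hB (i : ι) : m.1 i + ∑ j, |m.2 (i, j)| < (p ^ e : ℕ) := by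
    have h1 : B i ≤ e := (Finset.le_sup (Finset.mem_univ i)).trans ((le_max_right _ _).trans he)
    have h2 : e < p ^ e := Nat.lt_pow_self (Fact.out : p.Prime).one_lt
    have h3 : (B i : ℤ) < (p ^ e : ℕ) := by exact_mod_cast h1.trans_lt h2
    exact (Int.self_le_toNat _).trans_lt h3
  obtain ⟨k, hk, htr⟩ := he₀ e ((le_max_left _ _).trans he)
  have hmem (x : R) : ∃ y, ψ y = AddMonoidAlgebra.frobeniusTrace p e m (ψ x) := by
    refine (hrange _).2 fun t ht => isDegree_of_add_nsmul hmdeg hB ((hrange _).1 ⟨x, rfl⟩ _ ?_)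
    rw [AddMonoidAlgebra.coeff_frobeniusTrace] at ht
    simpa using ht
  choose g hg using hmem
  -- The trace of `c` is the constant `k`; multiplying by `k⁻¹` normalizes it to `1`.
  obtain ⟨r₀, hr₀⟩ : ∃ r, ψ r = .single 0 k⁻¹ := by
    refine (hrange _).2 fun t ht => ?_
    by_cases h : t = 0
    · subst h; exact ⟨by simp, by simp⟩
    · exact absurd (Finsupp.single_eq_of_ne h) ht
  refine ⟨AddMonoidHom.mk' (fun x => r₀ * g x) fun x y => hψ ?_, fun r x => hψ ?_, hψ ?_⟩
  · simp [hg, mul_add]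
  · simp [hg, AddMonoidAlgebra.frobeniusTrace_pow_mul, mul_left_comm]
  · simp [hg, htr, hr₀, AddMonoidAlgebra.single_mul_single, hk, AddMonoidAlgebra.one_def]

variable [DecidableEq ι]

/-- The embedding of the quotient by the `2 × 2` principal minors induced by `toric`. -/
noncomputable def quotientToric (I : Ideal (MvPolynomial (ι × ι) K)) (hI : I = minorIdeal ι K) :
    MvPolynomial (ι × ι) K ⧸ I →+* AddMonoidAlgebra K ((ι → ℤ) × (ι × ι → ℤ)) :=
  Ideal.Quotient.lift I (toric ι K : MvPolynomial (ι × ι) K →+* _) fun _ ha =>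
    minorIdeal_le_ker (hI ▸ ha)

theorem quotientToric_injective (I : Ideal (MvPolynomial (ι × ι) K)) (hI : I = minorIdeal ι K) :
    Function.Injective (quotientToric I hI) := by
  refine RingHom.lift_injective_of_ker_le_ideal _ _ ?_
  exact (ker_toric.trans hI.symm).le

theorem mem_range_quotientToric (I : Ideal (MvPolynomial (ι × ι) K)) (hI : I = minorIdeal ι K)
    (f : AddMonoidAlgebra K ((ι → ℤ) × (ι × ι → ℤ))) :
    f ∈ (quotientToric I hI).range ↔ ∀ s, f.coeff s ≠ 0 → IsDegree s := by
  rw [← mem_range_toric]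
  constructor
  · rintro ⟨x, rfl⟩
    obtain ⟨P, rfl⟩ := Ideal.Quotient.mk_surjective x
    exact ⟨P, rfl⟩
  · rintro ⟨P, rfl⟩
    exact ⟨Ideal.Quotient.mk I P, rfl⟩

theorem principalMinorIdeal_two (K : Type*) [Field K] (n : ℕ) :
    principalMinorIdeal K n 2 = minorIdeal (Fin n) K := by
  refine le_antisymm (Ideal.span_mono ?_) (Ideal.span_mono ?_)
  · rintro _ ⟨s, hs, rfl⟩
    obtain ⟨a, -, b, -, hab, h⟩ := exists_det_submatrix_mvPolynomialX_eq (K := K) hs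
    exact ⟨a, b, hab, h⟩
  · rintro _ ⟨i, j, hij, rfl⟩
    refine ⟨{i, j}, Finset.card_pair hij, ?_⟩
    obtain ⟨a, ha, b, hb, hab, h⟩ :=
      exists_det_submatrix_mvPolynomialX_eq (K := K) (Finset.card_pair hij)
    rw [h]
    simp only [Finset.mem_insert, Finset.mem_singleton] at ha hb
    rcases ha with rfl | rfl <;> rcases hb with rfl | rfl
    · exact absurd rfl hab
    · rfl
    · ring
    · exact absurd rfl hab

end PrincipalMinors

theorem corollary2p3 (K : Type*) [Field K] [IsAlgClosed K] (p : ℕ) [Fact p.Prime] [CharP K p]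
    (n : ℕ) :
    IsStronglyFRegular p (MvPolynomial (Fin n × Fin n) K ⧸ principalMinorIdeal K n 2) ∧
      IsFRegular p (MvPolynomial (Fin n × Fin n) K ⧸ principalMinorIdeal K n 2) := by
  have hI := PrincipalMinors.principalMinorIdeal_two K n
  have hinj := PrincipalMinors.quotientToric_injective _ hI
  have : IsDomain (MvPolynomial (Fin n × Fin n) K ⧸ principalMinorIdeal K n 2) :=
    hinj.isDomain (PrincipalMinors.quotientToric _ hI)
  have : CharP (MvPolynomial (Fin n × Fin n) K ⧸ principalMinorIdeal K n 2) p :=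
    charP_of_injective_algebraMap (algebraMap K _).injective p
  have h := PrincipalMinors.hasFrobeniusSplittings_of_range p _ hinj
    (PrincipalMinors.mem_range_quotientToric _ hI)
  exact ⟨h.isStronglyFRegular Fact.out
    (isFFinite_of_surjective p _ Ideal.Quotient.mk_surjective), h.isFRegular Fact.out⟩
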